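/- Let $(X,\mathcal X)$ be a measurable space, let $V:X\to[1,+\infty)$ be measurable, and let $P$ be a Markov transition kernel on $X$ which has an invariant probability measure $\pi$ such that $\pi(V):=\int V\,d\pi<\infty$. Let $(\mathcal B_V,\|\cdot\|_V)$ be the space of all measurable $f:X\to\mathbb C$ with $\|f\|_V:=\sup_{x\in X}|f(x)|/V(x)<\infty$. The kernel $P$ acts on functions by $(Pf)(x)=\int f(y)\,P(x,dy)$; if $PV\le CV$ for some finite constant $C$, this defines a bounded linear operator on $\mathcal B_V$, and $\|\cdot\|_V$ also denotes the operator norm. Definitions. $P$ is $V$-geometrically ergodic if there are $c>0$ and $\rho\in(0,1)$ such that for all $n\ge 0$, all measurable $f$ with $|f|\le V$ and all $x\in X$, the integral $(P^nf)(x)=\int f(y)\,P^n(x,dy)$ converges absolutely and $|(P^nf)(x)-\pi(f)|\le c\,\rho^n\,V(x)$. The convergence rate is $$\rho_V(P):=\inf\Big\{\rho\in(0,1):\ \sup_{\|f\|_V\le1}\|P^nf-\pi(f)1_X\|_V=O(\rho^n)\Big\}.$$ A number $r_0\in(0,1)$ is admissible for the bounded operator $P$ on $\mathcal B_V$ if there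 are $m\ge1$, $\lambda_1,\dots,\lambda_m\in\mathbb C$, $p_1,\dots,p_m\ge1$ and a closed $P$-invariant subspace $H$ of $\mathcal B_V$ such that $$\mathcal B_V=\bigoplus_{i=1}^m\ker(P-\lambda_iI)^{p_i}\oplus H,\qquad |\lambda_i|\ge r_0,\quad 1\le\dim\ker(P-\lambda_iI)^{p_i}<\infty,$$ $$\inf_{n\ge1}\Big(\sup_{h\in H,\ \|h\|_V\le1}\|P^nh\|_V\Big)^{1/n}<r_0.$$ $P$ is quasi-compact on $\mathcal B_V$ if some $r_0\in(0,1)$ is admissible, and then its essential spectral radius $r_{ess}(P)$ is the infimum of the admissible $r_0\in(0,1)$. $P$ is power-bounded on $\mathcal B_V$ if it is bounded and $\sup_{n\ge1}\|P^n\|_V<\infty$. Eigenvalues of $P$ are those of the operator on $\mathcal B_V$. Proposition. The following two assertions are equivalent: (a) $P$ is $V$-geometrically ergodic. (b) $P$ is a power-bounded quasi-compact operator on $\mathcal B_V$, for which $\lambda=1$ is a simple eigenvalue (i.e. $\ker(P-I)=\mathbb C\cdot 1_X$) and the unique eigenvalue of modulus one. Under any of these conditions, $\rho_V(P)\ge r_{ess}(P)$.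 Moreover, for every $r_0\in(r_{ess}(P),1)$, denoting by $\mathcal V_{r_0}$ the set of all the eigenvalues $\lambda$ of $P$ such that $r_0\le|\lambda|<1$: - if $\mathcal V_{r_0}=\emptyset$, then $\rho_V(P)\le r_0$; - if $\mathcal V_{r_0}\ne\emptyset$, then $\rho_V(P)=\max\{|\lambda|:\lambda\in\mathcal V_{r_0}\}$. Finally, if $\mathcal V_{r_0}=\emptyset$ for all $r_0\in(r_{ess}(P),1)$, then $\rho_V(P)=r_{ess}(P)$. -/

import Mathlib

open MeasureTheory ProbabilityTheory Filter Set

noncomputable section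

/-! ### Quasi-compact and power-bounded operators on a complex normed space -/

section Operators

variable {E : Type*} [NormedAddCommGroup E] [NormedSpace ℂ E]

/-- The subspace `ker (T - μ I) ^ p`. -/
def powKer (T : E →L[ℂ] E) (μ : ℂ) (p : ℕ) : Submodule ℂ E :=
  LinearMap.ker (((T - μ • (1 : E →L[ℂ] E)) ^ p : E →L[ℂ] E) : E →ₗ[ℂ] E)

/-- `r₀` is admissible for `T`: the space `E` is the direct sum of finitely many (at least one)
nonzero finite-dimensional spaces `ker (T - μᵢ I) ^ pᵢ` with `|μᵢ| ≥ r₀`, `pᵢ ≥ 1`, and of a closed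
`T`-invariant subspace `H` with `inf_{n ≥ 1} ‖Tⁿ|_H‖ ^ (1 / n) < r₀`. -/
def HasQuasiCompactSplitting (T : E →L[ℂ] E) (r₀ : ℝ) : Prop :=
  ∃ (m : ℕ) (μ : Fin m → ℂ) (p : Fin m → ℕ) (H : Submodule ℂ E),
    1 ≤ m ∧ (∀ i, 1 ≤ p i) ∧
    iSupIndep (fun i => powKer T (μ i) (p i)) ∧
    IsCompl (⨆ i, powKer T (μ i) (p i)) H ∧
    (∀ i, r₀ ≤ ‖μ i‖ ∧ FiniteDimensional ℂ (powKer T (μ i) (p i)) ∧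
      1 ≤ Module.finrank ℂ (powKer T (μ i) (p i))) ∧
    IsClosed (H : Set E) ∧ (∀ h ∈ H, T h ∈ H) ∧
    (⨅ n : ℕ+, ‖(T ^ (n : ℕ)).comp H.subtypeL‖ ^ (1 / ((n : ℕ) : ℝ))) < r₀

/-- `T` is quasi-compact. -/
def IsQuasiCompact (T : E →L[ℂ] E) : Prop :=
  ∃ r₀ ∈ Ioo (0 : ℝ) 1, HasQuasiCompactSplitting T r₀

/-- The essential spectral radius of a quasi-compact operator `T`: the infimum of all
admissible `r₀ ∈ (0, 1)`. -/
def essSpectralRadius (T : E →L[ℂ] E) : ℝ :=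
  sInf {r₀ : ℝ | r₀ ∈ Ioo (0 : ℝ) 1 ∧ HasQuasiCompactSplitting T r₀}

/-- `T` is power-bounded: `sup_{n ≥ 1} ‖Tⁿ‖ < ∞`. -/
def IsPowerBounded (T : E →L[ℂ] E) : Prop :=
  ∃ C : ℝ, ∀ n : ℕ, 1 ≤ n → ‖T ^ n‖ ≤ C

/-- `μ` is an eigenvalue of `T` on `E`. -/
def IsEigenvalue (T : E →L[ℂ] E) (μ : ℂ) : Prop :=
  Module.End.HasEigenvalue (T : E →ₗ[ℂ] E) μ

end Operators

/-! ### The weighted-supremum space -/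

section WeightedSpace

/-- A measurable weight function `V : X → [1, ∞)`. -/
structure WeightFn (X : Type*) [MeasurableSpace X] where
  /-- the underlying function -/
  toFun : X → ℝ
  measurable : Measurable toFun
  one_le : ∀ x, 1 ≤ toFun x

variable {X : Type*} [MeasurableSpace X]

instance : CoeFun (WeightFn X) (fun _ => X → ℝ) := ⟨WeightFn.toFun⟩

theorem WeightFn.pos (V : WeightFn X) (x : X) : 0 < V x := lt_of_lt_of_le one_pos (V.one_le x)

/-- The measurable functions `f : X → ℂ` with `sup_x |f x| / V x < ∞`, as a linear subspace. -/
def bvSubmodule (V : WeightFn X) : Submodule ℂ (X → ℂ) where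
  carrier := {f | Measurable f ∧ BddAbove (range fun x => ‖f x‖ / V x)}
  add_mem' := by
    rintro f g ⟨hf, C, hC⟩ ⟨hg, D, hD⟩
    refine ⟨hf.add hg, C + D, ?_⟩
    rintro _ ⟨x, rfl⟩
    have h1 := hC ⟨x, rfl⟩
    have h2 := hD ⟨x, rfl⟩
    have h3 : ‖(f + g) x‖ / V x ≤ ‖f x‖ / V x + ‖g x‖ / V x := by
      rw [← add_div]
      exact div_le_div_of_nonneg_right (norm_add_le _ _) (V.pos x).le
    exact h3.trans (add_le_add h1 h2)
  zero_mem' := ⟨measurable_const, 0, by rintro _ ⟨x, rfl⟩; simp⟩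
  smul_mem' := by
    rintro c f ⟨hf, C, hC⟩
    refine ⟨hf.const_smul c, ‖c‖ * C, ?_⟩
    rintro _ ⟨x, rfl⟩
    have h1 := hC ⟨x, rfl⟩
    have h3 : ‖(c • f) x‖ / V x = ‖c‖ * (‖f x‖ / V x) := by
      simp [mul_div_assoc]
    exact h3.le.trans (mul_le_mul_of_nonneg_left h1 (norm_nonneg c))

/-- The space `𝓑_V`. It is a type of its own, so that it carries only the norm defined below. -/
def BV (V : WeightFn X) : Type _ := ↥(bvSubmodule V)

instance (V : WeightFn X) : AddCommGroup (BV V) := inferInstanceAs (AddCommGroup ↥(bvSubmodule V))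

instance (V : WeightFn X) : Module ℂ (BV V) := inferInstanceAs (Module ℂ ↥(bvSubmodule V))

instance (V : WeightFn X) : CoeFun (BV V) (fun _ => X → ℂ) := ⟨fun f => f.1⟩

/-- The norm `‖f‖_V = sup_x |f x| / V x`. -/
instance (V : WeightFn X) : Norm (BV V) := ⟨fun f => ⨆ x, ‖f x‖ / V x⟩

theorem BV.norm_def {V : WeightFn X} (f : BV V) : ‖f‖ = ⨆ x, ‖f x‖ / V x := rfl

theorem BV.norm_apply_le {V : WeightFn X} (f : BV V) (x : X) : ‖f x‖ ≤ ‖f‖ * V x := by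
  rw [← div_le_iff₀ (V.pos x)]
  exact le_ciSup f.2.2 x

theorem BV.norm_le_of {V : WeightFn X} (f : BV V) {C : ℝ} (hC : 0 ≤ C)
    (h : ∀ x, ‖f x‖ ≤ C * V x) : ‖f‖ ≤ C :=
  Real.iSup_le (fun x => (div_le_iff₀ (V.pos x)).2 (h x)) hC

theorem BV.norm_nonneg' {V : WeightFn X} (f : BV V) : 0 ≤ ‖f‖ :=
  Real.iSup_nonneg fun x => div_nonneg (norm_nonneg _) (V.pos x).le

theorem BV.normCore (V : WeightFn X) : NormedSpace.Core ℂ (BV V) where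
  norm_nonneg := BV.norm_nonneg'
  norm_smul c f := by
    rw [BV.norm_def, BV.norm_def, Real.mul_iSup_of_nonneg (norm_nonneg c)]
    refine iSup_congr fun x => ?_
    have h : (c • f : BV V) x = c * f x := rfl
    rw [h, norm_mul, mul_div_assoc]
  norm_triangle f g := by
    refine BV.norm_le_of _ (add_nonneg f.norm_nonneg' g.norm_nonneg') fun x => ?_
    have h : (f + g : BV V) x = f x + g x := rfl
    rw [h, add_mul]
    exact (norm_add_le _ _).trans (add_le_add (f.norm_apply_le x) (g.norm_apply_le x))
  norm_eq_zero_iff f := by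
    constructor
    · intro h
      refine Subtype.ext (funext fun x => ?_)
      have h1 := f.norm_apply_le x
      rw [h, zero_mul] at h1
      exact norm_le_zero_iff.1 h1
    · rintro rfl
      refine le_antisymm (BV.norm_le_of _ le_rfl fun x => ?_) (BV.norm_nonneg' _)
      have h : (0 : BV V) x = 0 := rfl
      simp [h]

instance (V : WeightFn X) : NormedAddCommGroup (BV V) := NormedAddCommGroup.ofCore (BV.normCore V)

instance (V : WeightFn X) : NormedSpace ℂ (BV V) := NormedSpace.ofCore (BV.normCore V)

/-- The constant function `1_X`, as an element of `𝓑_V`. -/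
def BV.one (V : WeightFn X) : BV V :=
  ⟨fun _ => 1, measurable_const, 1, by
    rintro _ ⟨x, rfl⟩
    simpa using inv_le_one_of_one_le₀ (V.one_le x)⟩

end WeightedSpace

/-! ### Markov kernels -/

section Kernels

variable {X : Type*} [MeasurableSpace X]

/-- `P` is `V`-geometrically ergodic, with invariant measure `π`: with `P ^ n` the
`n`-step transition kernel, there are `c > 0` and
`ρ ∈ (0, 1)` such that for all `n`, all measurable `f` with `|f| ≤ V` and all `x`, the integral
`(Pⁿ f)(x) = 𝔼[f(Xₙ) ∣ X₀ = x]` converges absolutely and `|(Pⁿ f)(x) - π(f)| ≤ c ρⁿ V(x)`. -/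
def IsVGeometricallyErgodic (P : Kernel X X) (V : WeightFn X) (π : Measure X) : Prop :=
  ∃ c : ℝ, 0 < c ∧ ∃ ρ ∈ Ioo (0 : ℝ) 1, ∀ (n : ℕ) (f : X → ℂ), Measurable f →
    (∀ x, ‖f x‖ ≤ V x) → ∀ x : X,
      Integrable f ((P ^ n) x) ∧
        ‖(∫ y, f y ∂((P ^ n) x)) - ∫ y, f y ∂π‖ / V x ≤ c * ρ ^ n

/-- `P` acts continuously on `𝓑_V`: the function `PV` is finite and `PV ≤ C V` for some `C`. -/
def ActsOnBV (P : Kernel X X) (V : WeightFn X) : Prop :=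
  ∃ C : ℝ, ∀ x, Integrable V (P x) ∧ ∫ y, V y ∂(P x) ≤ C * V x

theorem ActsOnBV.integrable {P : Kernel X X} {V : WeightFn X} (hP : ActsOnBV P V) (f : BV V)
    (x : X) : Integrable f (P x) := by
  obtain ⟨C, hC⟩ := hP
  refine Integrable.mono' ((hC x).1.const_mul ‖f‖) f.2.1.aestronglyMeasurable ?_
  exact Eventually.of_forall fun y => f.norm_apply_le y

theorem kernel_integral_norm_le {P : Kernel X X} {V : WeightFn X} {C : ℝ}
    (hC : ∀ x, Integrable V (P x) ∧ ∫ y, V y ∂(P x) ≤ C * V x) (f : BV V) (x : X) :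
    ‖∫ y, f y ∂(P x)‖ ≤ |C| * ‖f‖ * V x := by
  calc ‖∫ y, f y ∂(P x)‖ ≤ ∫ y, ‖f‖ * V y ∂(P x) :=
        norm_integral_le_of_norm_le ((hC x).1.const_mul ‖f‖)
          (Eventually.of_forall fun y => f.norm_apply_le y)
    _ = ‖f‖ * ∫ y, V y ∂(P x) := integral_const_mul _ _
    _ ≤ ‖f‖ * (|C| * V x) :=
        mul_le_mul_of_nonneg_left ((hC x).2.trans
          (mul_le_mul_of_nonneg_right (le_abs_self C) (V.pos x).le)) f.norm_nonneg'
    _ = |C| * ‖f‖ * V x := by ring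

/-- The bounded operator `(P f)(x) = ∫ f(y) P(x, dy)` on `𝓑_V`. -/
def kernelOp (P : Kernel X X) [IsMarkovKernel P] (V : WeightFn X) (hP : ActsOnBV P V) :
    BV V →L[ℂ] BV V :=
  LinearMap.mkContinuousOfExistsBound
    { toFun := fun f =>
        ⟨fun x => ∫ y, f y ∂(P x),
          (StronglyMeasurable.integral_kernel f.2.1.stronglyMeasurable).measurable, by
            obtain ⟨C, hC⟩ := hP
            refine ⟨|C| * ‖f‖, ?_⟩
            rintro _ ⟨x, rfl⟩
            exact (div_le_iff₀ (V.pos x)).2 (kernel_integral_norm_le hC f x)⟩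
      map_add' := fun f g => Subtype.ext (funext fun x =>
        integral_add (hP.integrable f x) (hP.integrable g x))
      map_smul' := fun c f => Subtype.ext (funext fun x => integral_const_mul c _) }
    (by
      obtain ⟨C, hC⟩ := hP
      exact ⟨|C|, fun f => BV.norm_le_of _ (mul_nonneg (abs_nonneg C) f.norm_nonneg')
        fun x => kernel_integral_norm_le hC f x⟩)

theorem kernelOp_apply (P : Kernel X X) [IsMarkovKernel P] (V : WeightFn X) (hP : ActsOnBV P V)
    (f : BV V) (x : X) : kernelOp P V hP f x = ∫ y, f y ∂(P x) := rfl

/-- The convergence rate `ρ_V(P)`: the infimum of all `ρ ∈ (0, 1)` such that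
`sup_{‖f‖_V ≤ 1} ‖Pⁿ f - π(f) 1_X‖_V = O(ρⁿ)` as `n → ∞`. -/
def convergenceRate (P : Kernel X X) [IsMarkovKernel P] (V : WeightFn X) (hP : ActsOnBV P V)
    (π : Measure X) : ℝ :=
  sInf {ρ : ℝ | ρ ∈ Ioo (0 : ℝ) 1 ∧
    (fun n : ℕ => ⨆ f : {f : BV V // ‖f‖ ≤ 1},
      ‖(kernelOp P V hP ^ n) f.1 - (∫ y, f.1 y ∂π) • BV.one V‖) =O[atTop] fun n : ℕ => ρ ^ n}

/-- The eigenvalues `μ` of `P` on `𝓑_V` with `r₀ ≤ |μ| < 1`. -/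
def annulusEigenvalues (P : Kernel X X) [IsMarkovKernel P] (V : WeightFn X) (hP : ActsOnBV P V)
    (r₀ : ℝ) : Set ℂ :=
  {μ : ℂ | IsEigenvalue (kernelOp P V hP) μ ∧ r₀ ≤ ‖μ‖ ∧ ‖μ‖ < 1}

end Kernels

end

/-! `V`-geometric ergodicity says that the powers of `P` converge in operator norm on `𝓑_V`, at a
geometric rate, to the rank-one projection `f ↦ π(f) 1` (`ConvergesAtRate`).

Such convergence makes `P` contract like `ρⁿ` on the invariant hyperplane `ker π`, a complement of
the constants. So every `r > ρ` below `1` is admissible, and an eigenvalue other than `1`, whose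
eigenvectors lie in `ker π`, has modulus at most `ρ`. Hence every rate dominates `r_ess` and all
these moduli.

Conversely, take a splitting at `r` and `ρ ≥ r` above the moduli of the eigenvalues of modulus at
least `r` other than `1`. Then `H` and the generalized kernels for `μᵢ ≠ 1` have `O(ρⁿ)` orbits,
while power-boundedness excludes Jordan blocks at `1`. Thus `𝓑_V` is the sum of the constants and
the decaying vectors (`HasQuasiCompactSplitting.span_sup_decaySubmodule`), and Banach–Steinhaus
makes the pointwise decay uniform (`convergesAtRate_of_span_sup_decaySubmodule`). No spectral
projection is needed. Rerunning this with smaller `ρ` (`ConvergesAtRate.improve`) gives the upper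
bounds on the rate. -/

noncomputable section

/-! ### Orbit growth, generalized kernels and splittings for a bounded operator -/

section OperatorTheory

variable {E : Type*} [NormedAddCommGroup E] [NormedSpace ℂ E]

theorem mem_powKer {T : E →L[ℂ] E} {μ : ℂ} {p : ℕ} {v : E} :
    v ∈ powKer T μ p ↔ ((T - μ • (1 : E →L[ℂ] E)) ^ p) v = 0 := Iff.rfl

theorem mem_powKer_one {T : E →L[ℂ] E} {μ : ℂ} {v : E} :
    v ∈ powKer T μ 1 ↔ T v = μ • v := by
  rw [mem_powKer, pow_one]
  simp [sub_eq_zero]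

theorem isEigenvalue_iff {T : E →L[ℂ] E} {μ : ℂ} :
    IsEigenvalue T μ ↔ ∃ v : E, v ≠ 0 ∧ T v = μ • v := by
  constructor
  · intro h
    obtain ⟨v, hv⟩ := h.exists_hasEigenvector
    exact ⟨v, hv.2, hv.apply_eq_smul⟩
  · rintro ⟨v, hv, h⟩
    exact Module.End.hasEigenvalue_of_hasEigenvector
      (Module.End.hasEigenvector_iff.2 ⟨Module.End.mem_eigenspace_iff.2 h, hv⟩)

theorem pow_apply_of_eigenvector {T : E →L[ℂ] E} {μ : ℂ} {v : E} (h : T v = μ • v) (n : ℕ) :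
    (T ^ n) v = μ ^ n • v := by
  induction n with
  | zero => simp
  | succ n ih => rw [pow_succ', mul_apply_eq_comp, ih, map_smul, h, smul_smul, pow_succ]

theorem isEigenvalue_of_powKer_ne_bot {T : E →L[ℂ] E} {μ : ℂ} {p : ℕ}
    (h : powKer T μ p ≠ ⊥) : IsEigenvalue T μ := by
  by_contra hμ
  refine h ((Submodule.eq_bot_iff _).2 ?_)
  induction p with
  | zero => intro v hv; simpa [mem_powKer] using hv
  | succ p ih =>
    intro v hv
    have hinj : ∀ w : E, T w = μ • w → w = 0 := fun w hw => by
      by_contra hw0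
      exact hμ (isEigenvalue_iff.2 ⟨w, hw0, hw⟩)
    rw [mem_powKer, pow_succ'] at hv
    have h1 := hinj _ (mem_powKer_one.1 (by rw [mem_powKer, pow_one]; exact hv))
    -- The induction hypothesis is only available when the smaller kernel is nonzero.
    by_cases hp : powKer T μ p = ⊥
    · exact (Submodule.eq_bot_iff _).1 hp v h1
    · exact ih hp v h1

/-- The vectors whose orbit under `T` is `O(ρⁿ)`. -/
def decaySubmodule (T : E →L[ℂ] E) (ρ : ℝ) : Submodule ℂ E where
  carrier := {v | ∃ C : ℝ, ∀ n : ℕ, ‖(T ^ n) v‖ ≤ C * ρ ^ n}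
  add_mem' := by
    rintro v w ⟨C, hC⟩ ⟨D, hD⟩
    refine ⟨C + D, fun n => ?_⟩
    rw [map_add, add_mul]
    exact (norm_add_le _ _).trans (add_le_add (hC n) (hD n))
  zero_mem' := ⟨0, fun n => by simp⟩
  smul_mem' := by
    rintro c v ⟨C, hC⟩
    refine ⟨‖c‖ * C, fun n => ?_⟩
    rw [map_smul, norm_smul, mul_assoc]
    exact mul_le_mul_of_nonneg_left (hC n) (norm_nonneg c)

/-- A Jordan block contributes only a polynomial factor to `‖μ‖ ^ n`, and the strict gap `‖μ‖ < ρ`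
absorbs it. -/
theorem powKer_le_decaySubmodule {T : E →L[ℂ] E} {μ : ℂ} {ρ : ℝ} (h : ‖μ‖ < ρ) (p : ℕ) :
    powKer T μ p ≤ decaySubmodule T ρ := by
  have hρ : 0 < ρ := (norm_nonneg μ).trans_lt h
  induction p with
  | zero =>
    intro v hv
    have : v = 0 := by simpa [mem_powKer] using hv
    exact this ▸ zero_mem _
  | succ p ih =>
    intro v hv
    have hw : (T - μ • (1 : E →L[ℂ] E)) v ∈ powKer T μ p := by
      rw [mem_powKer, pow_succ] at hv
      exact hv
    obtain ⟨C, hC⟩ := ih hw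
    have hTv : T v = μ • v + (T - μ • (1 : E →L[ℂ] E)) v := by simp
    generalize (T - μ • (1 : E →L[ℂ] E)) v = w at hC hTv
    have hstep : ∀ n, (T ^ (n + 1)) v = μ • (T ^ n) v + (T ^ n) w := fun n => by
      rw [pow_succ, mul_apply_eq_comp, hTv, map_add, map_smul]
    have hd : 0 < ρ - ‖μ‖ := sub_pos.2 h
    -- With this constant `D`, one has `C ≤ D (ρ - ‖μ‖)`, so the bound `D ρⁿ` reproduces itself
    -- under `aₙ₊₁ ≤ ‖μ‖ aₙ + C ρⁿ`.
    refine ⟨max ‖v‖ (C / (ρ - ‖μ‖)), fun n => ?_⟩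
    have hD := (div_le_iff₀ hd).1 (le_max_right ‖v‖ (C / (ρ - ‖μ‖)))
    induction n with
    | zero => simp
    | succ n ihn =>
      set D := max ‖v‖ (C / (ρ - ‖μ‖))
      calc ‖(T ^ (n + 1)) v‖ ≤ ‖μ‖ * ‖(T ^ n) v‖ + ‖(T ^ n) w‖ := by
            rw [hstep]
            exact (norm_add_le _ _).trans_eq (by rw [norm_smul])
        _ ≤ ‖μ‖ * (D * ρ ^ n) + D * (ρ - ‖μ‖) * ρ ^ n :=
            add_le_add (mul_le_mul_of_nonneg_left ihn (norm_nonneg μ))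
              ((hC n).trans (mul_le_mul_of_nonneg_right hD (pow_pos hρ n).le))
        _ = D * ρ ^ (n + 1) := by ring

theorem decaySubmodule_mono {T : E →L[ℂ] E} {r ρ : ℝ} (hr : 0 ≤ r) (h : r ≤ ρ) :
    decaySubmodule T r ≤ decaySubmodule T ρ := by
  rintro v ⟨C, hC⟩
  refine ⟨|C|, fun n => (hC n).trans ?_⟩
  exact mul_le_mul (le_abs_self C) (pow_le_pow_left₀ hr h n) (pow_nonneg hr n) (abs_nonneg C)

/-- An invariant subspace on which some power of `T` has norm less than `r ^ k` consists of vectors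
with `O(rⁿ)` orbit. -/
theorem le_decaySubmodule_of_iInf_lt {T : E →L[ℂ] E} {H : Submodule ℂ E} {r : ℝ} (hr : 0 < r)
    (hH : ∀ h ∈ H, T h ∈ H)
    (hlt : (⨅ n : ℕ+, ‖(T ^ (n : ℕ)).comp H.subtypeL‖ ^ (1 / ((n : ℕ) : ℝ))) < r) :
    H ≤ decaySubmodule T r := by
  obtain ⟨k, hk⟩ := exists_lt_of_ciInf_lt hlt
  have hkr : ‖(T ^ (k : ℕ)).comp H.subtypeL‖ ≤ r ^ (k : ℕ) := by
    rw [one_div, Real.rpow_inv_lt_iff_of_pos (by positivity) hr.le (by positivity),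
      Real.rpow_natCast] at hk
    exact hk.le
  intro h hh
  have hpow : ∀ n, (T ^ n) h ∈ H := fun n => by
    induction n with
    | zero => simpa
    | succ n ih => rw [pow_succ']; exact hH _ ih
  have hstep : ∀ n, ‖(T ^ (n + k)) h‖ ≤ r ^ (k : ℕ) * ‖(T ^ n) h‖ := fun n => by
    have h1 := ((T ^ (k : ℕ)).comp H.subtypeL).le_opNorm ⟨_, hpow n⟩
    rw [add_comm, pow_add]
    exact h1.trans (mul_le_mul_of_nonneg_right hkr (norm_nonneg _))
  -- The sum covers the first `k` iterates; `hstep` then propagates the bound in jumps of `k`.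
  refine ⟨∑ i ∈ Finset.range k, ‖(T ^ i) h‖ / r ^ i, fun n => ?_⟩
  induction n using Nat.strong_induction_on with
  | _ n ih =>
    by_cases hn : n < k
    · rw [← div_le_iff₀ (pow_pos hr n)]
      exact Finset.single_le_sum (f := fun i => ‖(T ^ i) h‖ / r ^ i)
        (fun i _ => by positivity) (Finset.mem_range.2 hn)
    · obtain ⟨j, rfl⟩ := Nat.exists_eq_add_of_le' (not_lt.1 hn)
      refine (hstep j).trans ?_
      have h2 := mul_le_mul_of_nonneg_left (ih j (by have := k.pos; omega)) (pow_pos hr (k : ℕ)).le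
      exact h2.trans_eq (by ring)

theorem norm_eigenvalue_le_of_mem_decaySubmodule {T : E →L[ℂ] E} {μ : ℂ} {ρ : ℝ} {v : E}
    (hρ : 0 < ρ) (hv : v ≠ 0) (h : T v = μ • v) (hd : v ∈ decaySubmodule T ρ) : ‖μ‖ ≤ ρ := by
  obtain ⟨C, hC⟩ := hd
  by_contra! hlt
  have hv' : 0 < ‖v‖ := norm_pos_iff.2 hv
  obtain ⟨n, hn⟩ := pow_unbounded_of_one_lt (C / ‖v‖) ((one_lt_div hρ).2 hlt)
  have h1 := hC n
  rw [pow_apply_of_eigenvector h, norm_smul, norm_pow] at h1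
  rw [div_lt_iff₀ hv', div_pow, div_mul_eq_mul_div, lt_div_iff₀ (pow_pos hρ n)] at hn
  exact absurd h1 (not_le.2 hn)

theorem IsPowerBounded.mem_decaySubmodule_one {T : E →L[ℂ] E} (hT : IsPowerBounded T) (v : E) :
    v ∈ decaySubmodule T 1 := by
  obtain ⟨C, hC⟩ := hT
  refine ⟨max ‖v‖ (C * ‖v‖), fun n => ?_⟩
  rw [one_pow, mul_one]
  rcases n.eq_zero_or_pos with rfl | hn
  · simp
  · exact ((T ^ n).le_of_opNorm_le (hC n hn) v).trans (le_max_right _ _)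

theorem IsPowerBounded.norm_eigenvalue_le {T : E →L[ℂ] E} (hT : IsPowerBounded T) {μ : ℂ}
    (hμ : IsEigenvalue T μ) : ‖μ‖ ≤ 1 := by
  obtain ⟨v, hv, h⟩ := isEigenvalue_iff.1 hμ
  exact norm_eigenvalue_le_of_mem_decaySubmodule one_pos hv h (hT.mem_decaySubmodule_one v)

/-- A nontrivial Jordan block at `1` would give `Tⁿ v = v + n w` with `w ≠ 0`, an unbounded orbit.
-/
theorem IsPowerBounded.powKer_one_le {T : E →L[ℂ] E} (hT : IsPowerBounded T) (p : ℕ) :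
    powKer T 1 p ≤ powKer T 1 1 := by
  have key : ∀ v w : E, T v = v + w → T w = w → w = 0 := by
    intro v w hv hw
    obtain ⟨C, hC⟩ := hT.mem_decaySubmodule_one v
    have hn : ∀ n : ℕ, (T ^ n) v = v + (n : ℂ) • w := fun n => by
      induction n with
      | zero => simp
      | succ n ih =>
        rw [pow_succ', mul_apply_eq_comp, ih, map_add, map_smul, hv, hw]
        push_cast
        module
    by_contra hw0
    have hw' : 0 < ‖w‖ := norm_pos_iff.2 hw0
    obtain ⟨n, hn'⟩ := exists_nat_gt ((C + ‖v‖) / ‖w‖)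
    rw [div_lt_iff₀ hw'] at hn'
    have h1 := hC n
    rw [hn, one_pow, mul_one] at h1
    have h2 : ‖(n : ℂ) • w‖ ≤ ‖v + (n : ℂ) • w‖ + ‖v‖ := by
      simpa using norm_sub_le (v + (n : ℂ) • w) v
    rw [norm_smul, Complex.norm_natCast] at h2
    linarith
  induction p with
  | zero =>
    intro v hv
    have : v = 0 := by simpa [mem_powKer] using hv
    exact this ▸ zero_mem _
  | succ p ih =>
    intro v hv
    rw [mem_powKer, pow_succ] at hv
    have hw := mem_powKer_one.1 (ih (mem_powKer.2 hv))
    replace hw := hw.trans (one_smul ℂ _)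
    rw [mem_powKer, pow_one]
    exact key v ((T - (1 : ℂ) • (1 : E →L[ℂ] E)) v) (by simp) hw

theorem finite_eigenvalues_of_invariant {T : E →L[ℂ] E} (F : Submodule ℂ E)
    [FiniteDimensional ℂ F] (hF : ∀ u ∈ F, T u ∈ F) :
    {μ : ℂ | ∃ v ∈ F, v ≠ 0 ∧ T v = μ • v}.Finite := by
  refine (Module.End.finite_hasEigenvalue
    (LinearMap.restrict (T : E →ₗ[ℂ] E) hF)).subset ?_
  rintro μ ⟨v, hvF, hv0, hv⟩
  refine Module.End.hasEigenvalue_of_hasEigenvector (x := ⟨v, hvF⟩)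
    (Module.End.hasEigenvector_iff.2 ⟨Module.End.mem_eigenspace_iff.2 (Subtype.ext hv), ?_⟩)
  simpa using hv0

/-- The powers of `T` converge in operator norm to the rank-one operator `φ(·) e`, at rate `ρ`. -/
def ConvergesAtRate (T : E →L[ℂ] E) (e : E) (φ : E →L[ℂ] ℂ) (ρ : ℝ) : Prop :=
  ∃ C : ℝ, 0 < C ∧ ∀ n f, ‖(T ^ n) f - φ f • e‖ ≤ C * ρ ^ n * ‖f‖

/-- A continuous functional invariant under `T` vanishes on exponentially decaying orbits, so the
orbits of `T` converge to the rank-one limit `φ(·) e` at a uniform rate. -/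
theorem convergesAtRate_of_span_sup_decaySubmodule [CompleteSpace E] {T : E →L[ℂ] E} {e : E}
    {φ : E →L[ℂ] ℂ} {ρ : ℝ} (hρ : ρ ∈ Ioo (0 : ℝ) 1) (hTe : T e = e) (hφe : φ e = 1) (hφT : ∀ f, φ (T f) = φ f)
    (htop : Submodule.span ℂ {e} ⊔ decaySubmodule T ρ = ⊤) :
    ConvergesAtRate T e φ ρ := by
  have hTn : ∀ n, (T ^ n) e = e := fun n => by
    simpa using pow_apply_of_eigenvector (T := T) (μ := 1) (by simpa using hTe) n
  have hφn : ∀ n f, φ ((T ^ n) f) = φ f := fun n f => by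
    induction n with
    | zero => simp
    | succ n ih => rw [pow_succ', mul_apply_eq_comp, hφT, ih]
  have hφ0 : ∀ v ∈ decaySubmodule T ρ, φ v = 0 := by
    rintro v ⟨C, hC⟩
    have hlim : Tendsto (fun n : ℕ => ‖φ‖ * (C * ρ ^ n)) atTop (nhds (‖φ‖ * (C * 0))) :=
      ((tendsto_pow_atTop_nhds_zero_of_lt_one hρ.1.le hρ.2).const_mul C).const_mul ‖φ‖
    have h1 : ‖φ v‖ ≤ ‖φ‖ * (C * 0) := ge_of_tendsto' hlim fun n => by
      rw [← hφn n v]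
      exact (φ.le_opNorm _).trans (mul_le_mul_of_nonneg_left (hC n) (norm_nonneg φ))
    simpa using h1
  -- Errors rescaled by `ρⁿ`: bounded on each vector, with a bound depending on the vector, hence
  -- bounded in norm by Banach–Steinhaus.
  let S : ℕ → E →L[ℂ] E := fun n => ((ρ : ℂ) ^ n)⁻¹ • (T ^ n - φ.smulRight e)
  have hS : ∀ n f, ‖S n f‖ = ‖(T ^ n) f - φ f • e‖ / ρ ^ n := fun n f => by
    simp [S, norm_smul, abs_of_pos hρ.1, div_eq_inv_mul]
  have hbd : ∀ f, ∃ C, ∀ n, ‖S n f‖ ≤ C := fun f => by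
    have hf : f ∈ Submodule.span ℂ {e} ⊔ decaySubmodule T ρ := htop ▸ Submodule.mem_top
    obtain ⟨u, hu, v, hv, rfl⟩ := Submodule.mem_sup.1 hf
    obtain ⟨a, rfl⟩ := Submodule.mem_span_singleton.1 hu
    obtain ⟨C, hC⟩ := id hv
    refine ⟨C, fun n => ?_⟩
    rw [hS, div_le_iff₀ (pow_pos hρ.1 n)]
    have hsum : (T ^ n) (a • e + v) - φ (a • e + v) • e = (T ^ n) v := by
      rw [map_add, map_add, map_smul, map_smul, hTn, hφe, hφ0 v hv, add_zero, smul_eq_mul, mul_one,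
        add_sub_cancel_left]
    rw [hsum]
    exact hC n
  obtain ⟨C, hC⟩ := banach_steinhaus hbd
  refine ⟨|C| + 1, by positivity, fun n f => ?_⟩
  have h1 := (S n).le_of_opNorm_le (hC n) f
  rw [hS, div_le_iff₀ (pow_pos hρ.1 n)] at h1
  refine h1.trans ?_
  have h2 : C ≤ |C| + 1 := (le_abs_self C).trans (by linarith)
  have h3 : 0 ≤ ‖f‖ * ρ ^ n := mul_nonneg (norm_nonneg f) (pow_pos hρ.1 n).le
  nlinarith

/-- Given a splitting of `E` relative to `r ≤ ρ`, if the only eigenvalue of modulus at least `ρ` of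
the power-bounded `T` is the simple eigenvalue `1`, then all orbits outside the eigenspace of `1`
are `O(ρⁿ)`. -/
theorem HasQuasiCompactSplitting.span_sup_decaySubmodule {T : E →L[ℂ] E} {r ρ : ℝ}
    (h : HasQuasiCompactSplitting T r) (hr : 0 < r) (hrρ : r ≤ ρ) (hT : IsPowerBounded T) {e : E}
    (he : powKer T 1 1 = Submodule.span ℂ {e})
    (hρ : ∀ μ, IsEigenvalue T μ → r ≤ ‖μ‖ → μ ≠ 1 → ‖μ‖ < ρ) :
    Submodule.span ℂ {e} ⊔ decaySubmodule T ρ = ⊤ := by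
  obtain ⟨m, μ, p, H, -, -, -, hc, hμ, -, hH, hlt⟩ := h
  rw [eq_top_iff, ← hc.sup_eq_top]
  refine sup_le (iSup_le fun i => ?_) ?_
  · by_cases h1 : μ i = 1
    · rw [h1]
      exact ((hT.powKer_one_le _).trans he.le).trans le_sup_left
    · refine (powKer_le_decaySubmodule (hρ _ ?_ (hμ i).1 h1) _).trans le_sup_right
      refine isEigenvalue_of_powKer_ne_bot (p := p i) fun h0 => ?_
      have := (hμ i).2.2
      rw [h0, finrank_bot] at this
      omega
  · exact ((le_decaySubmodule_of_iInf_lt hr hH hlt).trans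
      (decaySubmodule_mono hr.le hrρ)).trans le_sup_right

/-- Both summands are invariant, so the components of an eigenvector satisfy the same eigenvalue
equation. The one in `H` has an `O(rⁿ)` orbit and must vanish when the modulus exceeds `r`; the
eigenvector then lies in a finite-dimensional invariant space. -/
theorem HasQuasiCompactSplitting.finite_eigenvalues {T : E →L[ℂ] E} {r : ℝ}
    (h : HasQuasiCompactSplitting T r) (hr : 0 < r) :
    {μ : ℂ | IsEigenvalue T μ ∧ r < ‖μ‖}.Finite := by
  obtain ⟨m, μ, p, H, -, -, -, hc, hμ, -, hH, hlt⟩ := h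
  have hfin : ∀ i, FiniteDimensional ℂ (powKer T (μ i) (p i)) := fun i => (hμ i).2.1
  have hF : ∀ u ∈ ⨆ i, powKer T (μ i) (p i), T u ∈ ⨆ i, powKer T (μ i) (p i) := by
    intro u hu
    induction hu using Submodule.iSup_induction' with
    | mem i u hu =>
      refine Submodule.mem_iSup_of_mem i ?_
      have hcomm : Commute ((T - μ i • (1 : E →L[ℂ] E)) ^ p i) T :=
        (((Commute.refl T).sub_left ((Commute.one_left T).smul_left _))).pow_left _
      rw [mem_powKer] at hu ⊢
      rw [← mul_apply_eq_comp, hcomm.eq, mul_apply_eq_comp, hu, map_zero]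
    | zero => simp
    | add u w _ _ h1 h2 => rw [map_add]; exact add_mem h1 h2
  refine (finite_eigenvalues_of_invariant (T := T) _ hF).subset ?_
  rintro ν ⟨hν, hlt'⟩
  obtain ⟨v, hv0, hv⟩ := isEigenvalue_iff.1 hν
  refine ⟨v, ?_, hv0, hv⟩
  have hv' : v ∈ (⨆ i, powKer T (μ i) (p i)) ⊔ H := hc.sup_eq_top ▸ Submodule.mem_top
  obtain ⟨u, hu, w, hw, rfl⟩ := Submodule.mem_sup.1 hv'
  have heq : T u - ν • u = -(T w - ν • w) := by
    rw [map_add, smul_add] at hv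
    rw [eq_neg_iff_add_eq_zero, sub_add_sub_comm, hv, sub_self]
  have h0 : T u - ν • u = 0 := Submodule.disjoint_def.1 hc.disjoint _
    (sub_mem (hF u hu) (Submodule.smul_mem _ _ hu))
    (heq ▸ neg_mem (sub_mem (hH w hw) (Submodule.smul_mem _ _ hw)))
  rw [h0, eq_comm, neg_eq_zero, sub_eq_zero] at heq
  have hw0 : w = 0 := by
    by_contra hw0
    exact absurd (norm_eigenvalue_le_of_mem_decaySubmodule hr hw0 heq
      (le_decaySubmodule_of_iInf_lt hr hH hlt hw)) (not_le.2 hlt')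
  rwa [hw0, add_zero]

/-! ### Spectral consequences of convergence to a rank-one limit -/

namespace ConvergesAtRate

variable {T : E →L[ℂ] E} {e : E} {φ : E →L[ℂ] ℂ} {ρ : ℝ}

theorem isPowerBounded (h : ConvergesAtRate T e φ ρ) (hρ : ρ ∈ Ioo (0 : ℝ) 1) :
    IsPowerBounded T := by
  obtain ⟨C, hC0, hC⟩ := h
  refine ⟨C + ‖φ‖ * ‖e‖, fun n _ => ContinuousLinearMap.opNorm_le_bound _ (by positivity) fun f => ?_⟩
  calc ‖(T ^ n) f‖ ≤ ‖(T ^ n) f - φ f • e‖ + ‖φ f • e‖ := norm_le_norm_sub_add _ _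
    _ ≤ C * 1 * ‖f‖ + ‖φ‖ * ‖f‖ * ‖e‖ := by
        refine add_le_add ((hC n f).trans ?_) ?_
        · gcongr
          exact pow_le_one₀ hρ.1.le hρ.2.le
        · rw [norm_smul]
          gcongr
          exact φ.le_opNorm f
    _ = (C + ‖φ‖ * ‖e‖) * ‖f‖ := by ring

theorem mem_decaySubmodule (h : ConvergesAtRate T e φ ρ) {v : E} (hv : φ v = 0) :
    v ∈ decaySubmodule T ρ := by
  obtain ⟨C, -, hC⟩ := h
  refine ⟨C * ‖v‖, fun n => ?_⟩
  have h1 := hC n v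
  rw [hv, zero_smul, sub_zero] at h1
  exact h1.trans_eq (by ring)

/-- Invariance of `φ` gives `(μ - 1) φ v = 0`, so the eigenvector lies in `ker φ`, where orbits are
`O(ρⁿ)`. -/
theorem norm_eigenvalue_le (h : ConvergesAtRate T e φ ρ) (hρ : 0 < ρ)
    (hφT : ∀ f, φ (T f) = φ f) {μ : ℂ} (hμ : IsEigenvalue T μ) (hμ1 : μ ≠ 1) : ‖μ‖ ≤ ρ := by
  obtain ⟨v, hv0, hv⟩ := isEigenvalue_iff.1 hμ
  refine norm_eigenvalue_le_of_mem_decaySubmodule hρ hv0 hv (h.mem_decaySubmodule ?_)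
  have h1 := hφT v
  rw [hv, map_smul, smul_eq_mul, ← sub_eq_zero, ← sub_one_mul, mul_eq_zero, sub_eq_zero] at h1
  exact h1.resolve_left hμ1

theorem powKer_one_eq (h : ConvergesAtRate T e φ ρ) (hρ : ρ ∈ Ioo (0 : ℝ) 1) (hTe : T e = e)
    (hφe : φ e = 1) : powKer T 1 1 = Submodule.span ℂ {e} := by
  apply le_antisymm
  · intro v hv
    rw [mem_powKer_one] at hv
    have hw : φ (v - φ v • e) = 0 := by simp [hφe]
    have hTw : T (v - φ v • e) = (1 : ℂ) • (v - φ v • e) := by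
      rw [map_sub, map_smul, hTe, hv, one_smul, one_smul]
    have h0 : v - φ v • e = 0 := by
      by_contra h0
      have := norm_eigenvalue_le_of_mem_decaySubmodule hρ.1 h0 hTw (h.mem_decaySubmodule hw)
      rw [norm_one] at this
      exact absurd hρ.2 (not_lt.2 this)
    exact Submodule.mem_span_singleton.2 ⟨φ v, (sub_eq_zero.1 h0).symm⟩
  · rw [Submodule.span_singleton_le_iff_mem, mem_powKer_one, one_smul, hTe]

theorem isEigenvalue_and_norm_eq_one_iff (h : ConvergesAtRate T e φ ρ) (hρ : ρ ∈ Ioo (0 : ℝ) 1)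
    (hTe : T e = e) (hφe : φ e = 1) (hφT : ∀ f, φ (T f) = φ f) (μ : ℂ) :
    IsEigenvalue T μ ∧ ‖μ‖ = 1 ↔ μ = 1 := by
  constructor
  · rintro ⟨hμ, h1⟩
    by_contra hne
    exact absurd (h.norm_eigenvalue_le hρ.1 hφT hμ hne) (not_le.2 (h1 ▸ hρ.2))
  · rintro rfl
    exact ⟨isEigenvalue_iff.2 ⟨e, by rintro rfl; simp at hφe, by rw [one_smul, hTe]⟩, norm_one⟩

/-- Convergence at rate `ρ` to a rank-one limit makes every `r ∈ (ρ, 1]` admissible. -/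
theorem hasQuasiCompactSplitting (hconv : ConvergesAtRate T e φ ρ) {r : ℝ} (hρ : 0 < ρ)
    (hρr : ρ < r) (hr : r ≤ 1) (hTe : T e = e) (hφe : φ e = 1) (hφT : ∀ f, φ (T f) = φ f) :
    HasQuasiCompactSplitting T r := by
  have he := hconv.powKer_one_eq ⟨hρ, hρr.trans_le hr⟩ hTe hφe
  obtain ⟨C, hC0, hC⟩ := hconv
  have he0 : e ≠ 0 := by rintro rfl; simp at hφe
  refine ⟨1, fun _ => 1, fun _ => 1, LinearMap.ker (φ : E →ₗ[ℂ] ℂ), le_rfl, fun _ => le_rfl,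
    iSupIndep_subsingleton _, ?_, fun _ => ⟨by simpa using hr, ?_, ?_⟩,
    φ.isClosed_ker, fun h hh => ?_, ?_⟩
  · rw [iSup_const, he]
    constructor
    · rw [Submodule.disjoint_def]
      intro v hv hφv
      obtain ⟨a, rfl⟩ := Submodule.mem_span_singleton.1 hv
      have : a = 0 := by simpa [hφe] using hφv
      simp [this]
    · rw [codisjoint_iff, eq_top_iff]
      intro v _
      refine Submodule.mem_sup.2 ⟨φ v • e, Submodule.smul_mem _ _
        (Submodule.mem_span_singleton_self e), v - φ v • e, ?_, by abel⟩
      simp [hφe]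
  · rw [he]; infer_instance
  · rw [he, finrank_span_singleton he0]
  · have h1 : φ h = 0 := hh
    change φ (T h) = 0
    rw [hφT, h1]
  · set H := LinearMap.ker (φ : E →ₗ[ℂ] ℂ)
    have hlim : Tendsto (fun n : ℕ => C * (ρ / r) ^ n) atTop (nhds (C * 0)) :=
      (tendsto_pow_atTop_nhds_zero_of_lt_one (div_nonneg hρ.le (hρ.trans hρr).le)
        ((div_lt_one (hρ.trans hρr)).2 hρr)).const_mul _
    rw [mul_zero] at hlim
    -- A single positive `n` with `C ρⁿ < rⁿ` already pushes the infimum below `r`.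
    obtain ⟨n, hn2, hn0⟩ :=
      ((hlim.eventually (gt_mem_nhds one_pos)).and (eventually_gt_atTop 0)).exists
    have hr0 : 0 < r := hρ.trans hρr
    refine (ciInf_le ⟨0, ?_⟩ (⟨n, hn0⟩ : ℕ+)).trans_lt ?_
    · rintro _ ⟨k, rfl⟩
      positivity
    · have hnorm : ‖(T ^ n).comp H.subtypeL‖ ≤ C * ρ ^ n := by
        refine ContinuousLinearMap.opNorm_le_bound _ (by positivity) fun h => ?_
        have h1 := hC n h
        have h2 : φ (h : E) = 0 := h.2
        rw [h2, zero_smul, sub_zero] at h1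
        exact h1
      have hlt : ‖(T ^ n).comp H.subtypeL‖ < r ^ n := by
        rw [div_pow, ← mul_div_assoc, div_lt_one (pow_pos hr0 n)] at hn2
        exact hnorm.trans_lt hn2
      change ‖(T ^ n).comp H.subtypeL‖ ^ (1 / (n : ℝ)) < r
      rwa [one_div, Real.rpow_inv_lt_iff_of_pos (by positivity) hr0.le (by positivity),
        Real.rpow_natCast]

end ConvergesAtRate

end OperatorTheory

/-! ### Completeness of `𝓑_V` and integration against `π` -/

section WeightedSupremum

variable {X : Type*} [MeasurableSpace X] {V : WeightFn X}

theorem BV.sub_apply (f g : BV V) (x : X) : (f - g) x = f x - g x := rfl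

theorem BV.smul_apply (c : ℂ) (f : BV V) (x : X) : (c • f) x = c * f x := rfl

theorem BV.one_apply (x : X) : BV.one V x = 1 := rfl

/-- A measurable function dominated by a multiple of `V`, as an element of `𝓑_V`. -/
def BV.mk (f : X → ℂ) (hf : Measurable f) {C : ℝ} (hC : ∀ x, ‖f x‖ ≤ C * V x) : BV V :=
  ⟨f, hf, C, by
    rintro _ ⟨x, rfl⟩
    exact (div_le_iff₀ (V.pos x)).2 (hC x)⟩

instance BV.completeSpace : CompleteSpace (BV V) := by
  refine Metric.complete_of_cauchySeq_tendsto fun u hu => ?_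
  have hdist : ∀ m n x, ‖u m x - u n x‖ ≤ dist (u m) (u n) * V x := fun m n x => by
    rw [dist_eq_norm, ← BV.sub_apply]
    exact BV.norm_apply_le _ x
  have hpt : ∀ x, ∃ a, Tendsto (fun n => u n x) atTop (nhds a) := fun x => by
    refine cauchySeq_tendsto_of_complete (Metric.cauchySeq_iff.2 fun ε hε => ?_)
    obtain ⟨N, hN⟩ := Metric.cauchySeq_iff.1 hu (ε / V x) (div_pos hε (V.pos x))
    refine ⟨N, fun m hm n hn => ?_⟩
    rw [dist_eq_norm]
    exact (hdist m n x).trans_lt ((lt_div_iff₀ (V.pos x)).1 (hN m hm n hn))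
  choose g hg using hpt
  have hgm : Measurable g :=
    measurable_of_tendsto_metrizable (fun n => (u n).2.1) (tendsto_pi_nhds.2 hg)
  -- Letting one index tend to infinity in the Cauchy estimate keeps it uniform in `x`.
  have hlim : ∀ ε > 0, ∃ N, ∀ n ≥ N, ∀ x, ‖u n x - g x‖ ≤ ε * V x := fun ε hε => by
    obtain ⟨N, hN⟩ := Metric.cauchySeq_iff.1 hu ε hε
    refine ⟨N, fun n hn x => ?_⟩
    refine le_of_tendsto ((tendsto_const_nhds.sub (hg x)).norm)
      ((eventually_ge_atTop N).mono fun m hm => ?_)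
    exact (hdist n m x).trans (mul_le_mul_of_nonneg_right (hN n hn m hm).le (V.pos x).le)
  obtain ⟨N, hN⟩ := hlim 1 one_pos
  have hgV : ∀ x, ‖g x‖ ≤ (‖u N‖ + 1) * V x := fun x => by
    have h1 := (u N).norm_apply_le x
    have h2 := hN N le_rfl x
    have h3 : ‖g x‖ ≤ ‖u N x‖ + ‖u N x - g x‖ := by
      simpa using norm_sub_le (u N x) (u N x - g x)
    linarith
  refine ⟨BV.mk g hgm hgV, Metric.tendsto_atTop.2 fun ε hε => ?_⟩
  obtain ⟨M, hM⟩ := hlim (ε / 2) (half_pos hε)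
  refine ⟨M, fun n hn => ?_⟩
  rw [dist_eq_norm]
  exact (BV.norm_le_of _ (half_pos hε).le (hM n hn)).trans_lt (half_lt_self hε)

theorem BV.integrable {π : Measure X} (hV : Integrable V π) (f : BV V) : Integrable f π :=
  Integrable.mono' (hV.const_mul ‖f‖) f.2.1.aestronglyMeasurable
    (Eventually.of_forall fun y => f.norm_apply_le y)

/-- Integration against `π`, as a continuous linear functional on `𝓑_V`. -/
def BV.integralCLM (V : WeightFn X) (π : Measure X) (hV : Integrable V π) : BV V →L[ℂ] ℂ :=
  LinearMap.mkContinuous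
    { toFun := fun f => ∫ y, f y ∂π
      map_add' := fun f g => integral_add (f.integrable hV) (g.integrable hV)
      map_smul' := fun c f => integral_const_mul c _ }
    (∫ y, V y ∂π) fun f => by
      rw [mul_comm, ← integral_const_mul]
      exact norm_integral_le_of_norm_le (hV.const_mul ‖f‖)
        (Eventually.of_forall fun y => f.norm_apply_le y)

theorem BV.integralCLM_apply {π : Measure X} (hV : Integrable V π) (f : BV V) :
    BV.integralCLM V π hV f = ∫ y, f y ∂π := rfl

theorem BV.integralCLM_one {π : Measure X} [IsProbabilityMeasure π] (hV : Integrable V π) :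
    BV.integralCLM V π hV (BV.one V) = 1 := by
  simp [BV.integralCLM_apply, BV.one_apply]

end WeightedSupremum

/-! ### From kernels to operators -/

section KernelOperator

variable {X : Type*} [MeasurableSpace X] {P : Kernel X X} [IsMarkovKernel P] {V : WeightFn X}
  {π : Measure X}

theorem kernelOp_one (hP : ActsOnBV P V) : kernelOp P V hP (BV.one V) = BV.one V := by
  refine Subtype.ext (funext fun x => ?_)
  rw [kernelOp_apply]
  simp [BV.one_apply]

theorem integrable_kernel_pow_and_kernelOp_pow_apply (hP : ActsOnBV P V) (n : ℕ) (f : BV V)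
    (x : X) :
    Integrable f ((P ^ n) x) ∧ (kernelOp P V hP ^ n) f x = ∫ y, f y ∂((P ^ n) x) := by
  induction n generalizing f with
  | zero =>
    have h1 : (P ^ 0) x = Measure.dirac x := by rw [pow_zero]; exact Kernel.id_apply x
    rw [h1]
    refine ⟨integrable_dirac' f.2.1.stronglyMeasurable (by simp), ?_⟩
    rw [integral_dirac' _ _ f.2.1.stronglyMeasurable]
    rfl
  | succ n ih =>
    have h1 : (P ^ (n + 1)) x = (P ∘ₖ (P ^ n)) x := by rw [pow_succ']; rfl
    have hint : Integrable f ((P ∘ₖ (P ^ n)) x) := by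
      refine (integrable_comp_iff f.2.1.aestronglyMeasurable).2
        ⟨Eventually.of_forall fun y => hP.integrable f y, ?_⟩
      -- Integrability under the composed kernel requires `P|f|` to be integrable for the `n`-step
      -- kernel; since `P|f|` lies in `𝓑_V`, the induction hypothesis applies to it.
      let g : BV V := BV.mk (fun y => (‖f y‖ : ℂ)) (by have := f.2.1; fun_prop) (C := ‖f‖)
        fun y => by simpa using f.norm_apply_le y
      have h2 := (ih (kernelOp P V hP g)).1.re
      refine h2.congr (Eventually.of_forall fun y => ?_)
      have h3 : kernelOp P V hP g y = ((∫ z, ‖f z‖ ∂(P y) : ℝ) : ℂ) := integral_ofReal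
      simp [h3]
    rw [h1]
    refine ⟨hint, ?_⟩
    rw [Kernel.integral_comp hint, pow_succ, mul_apply_eq_comp, (ih _).2]
    rfl

theorem integralCLM_kernelOp (hP : ActsOnBV P V) (hπ : Kernel.Invariant P π)
    (hV : Integrable V π) (f : BV V) :
    BV.integralCLM V π hV (kernelOp P V hP f) = BV.integralCLM V π hV f := by
  -- Viewing `π` as a constant kernel lets the composition formula for kernels express invariance.
  have h1 : (P ∘ₖ Kernel.const Unit π) () = π := by
    rw [← Measure.comp_eq_comp_const_apply]; exact hπ
  have hf : Integrable f ((P ∘ₖ Kernel.const Unit π) ()) := by rw [h1]; exact f.integrable hV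
  have h2 := Kernel.integral_comp hf
  rw [h1, Kernel.const_apply] at h2
  exact h2.symm

theorem isVGeometricallyErgodic_iff (hV : Integrable V π) :
    IsVGeometricallyErgodic P V π ↔ ∃ hP : ActsOnBV P V, ∃ ρ ∈ Ioo (0 : ℝ) 1,
      ConvergesAtRate (kernelOp P V hP) (BV.one V) (BV.integralCLM V π hV) ρ := by
  constructor
  · rintro ⟨c, hc, ρ, hρ, h⟩
    have hP : ActsOnBV P V := by
      -- Ergodicity at `n = 1`, `f = V` gives `PV ≤ π(V) + c ρ V`, and `V ≥ 1` absorbs `π(V)`.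
      refine ⟨c * ρ + ∫ y, V y ∂π, fun x => ?_⟩
      obtain ⟨h1, h2⟩ := h 1 (fun y => (V y : ℂ)) (by have := V.measurable; fun_prop)
        (fun y => by simp [abs_of_pos (V.pos y)]) x
      rw [pow_one, div_le_iff₀ (V.pos x), pow_one, integral_complex_ofReal,
        integral_complex_ofReal, ← Complex.ofReal_sub, Complex.norm_real] at h2
      rw [pow_one] at h1
      refine ⟨by simpa using h1.re, ?_⟩
      have h3 : 0 ≤ ∫ y, V y ∂π := integral_nonneg fun y => (V.pos y).le
      have h4 := (abs_le.1 h2).2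
      nlinarith [V.one_le x]
    refine ⟨hP, ρ, hρ, c, hc, fun n f => ?_⟩
    have hρn : 0 < ρ ^ n := pow_pos hρ.1 n
    by_cases hf : ‖f‖ = 0
    · rw [norm_eq_zero.1 hf]; simp
    have hf0 : 0 < ‖f‖ := lt_of_le_of_ne (norm_nonneg f) (Ne.symm hf)
    refine BV.norm_le_of _ (by positivity) fun x => ?_
    obtain ⟨-, h2⟩ := h n (fun y => ((‖f‖⁻¹ : ℝ) : ℂ) * f y) (f.2.1.const_mul _)
      (fun y => by
        rw [norm_mul, Complex.norm_real, norm_inv, norm_norm, inv_mul_le_iff₀ hf0]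
        exact f.norm_apply_le y) x
    rw [div_le_iff₀ (V.pos x), integral_const_mul, integral_const_mul, ← mul_sub, norm_mul,
      Complex.norm_real, norm_inv, norm_norm, inv_mul_le_iff₀ hf0,
      ← (integrable_kernel_pow_and_kernelOp_pow_apply hP n f x).2] at h2
    rw [BV.sub_apply, BV.smul_apply, BV.one_apply, mul_one]
    exact h2.trans_eq (by ring)
  · rintro ⟨hP, ρ, hρ, c, hc, h⟩
    refine ⟨c, hc, ρ, hρ, fun n f hf hfV x => ?_⟩
    let g : BV V := BV.mk f hf (C := 1) fun y => by simpa using hfV y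
    have hg : ‖g‖ ≤ 1 := BV.norm_le_of _ zero_le_one fun y => by
      rw [one_mul]; exact hfV y
    have hgn := integrable_kernel_pow_and_kernelOp_pow_apply hP n g x
    refine ⟨hgn.1, ?_⟩
    rw [div_le_iff₀ (V.pos x)]
    have h1 := BV.norm_apply_le ((kernelOp P V hP ^ n) g - BV.integralCLM V π hV g • BV.one V) x
    rw [BV.sub_apply, BV.smul_apply, BV.one_apply, mul_one, hgn.2] at h1
    refine h1.trans (mul_le_mul_of_nonneg_right ((h n g).trans ?_) (V.pos x).le)
    exact mul_le_of_le_one_right (mul_nonneg hc.le (pow_pos hρ.1 n).le) hg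

theorem isBigO_iff_convergesAtRate (hP : ActsOnBV P V) (hV : Integrable V π) {ρ : ℝ}
    (hρ : 0 < ρ) :
    ((fun n : ℕ => ⨆ f : {f : BV V // ‖f‖ ≤ 1},
      ‖(kernelOp P V hP ^ n) f.1 - (∫ y, f.1 y ∂π) • BV.one V‖) =O[atTop] fun n : ℕ => ρ ^ n) ↔
    ConvergesAtRate (kernelOp P V hP) (BV.one V) (BV.integralCLM V π hV) ρ := by
  set T := kernelOp P V hP
  set φ := BV.integralCLM V π hV
  have hnorm : (fun n : ℕ => ⨆ f : {f : BV V // ‖f‖ ≤ 1},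
      ‖(T ^ n) f.1 - (∫ y, f.1 y ∂π) • BV.one V‖) = fun n => ‖T ^ n - φ.smulRight (BV.one V)‖ := by
    funext n
    -- The supremum over the unit ball is the operator norm of `Tⁿ - φ(·) 1`.
    rw [← ContinuousLinearMap.sSup_unitClosedBall_eq_norm, sSup_image']
    refine Equiv.iSup_congr (Equiv.subtypeEquivRight fun f => by simp) fun f => rfl
  rw [hnorm]
  constructor
  · intro h
    -- Since `ρⁿ` never vanishes, enlarging the constant turns the asymptotic bound into one for all
    -- `n`.
    obtain ⟨C, hC, h⟩ := Asymptotics.bound_of_isBigO_nat_atTop h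
    refine ⟨C, hC, fun n f => ?_⟩
    have h1 := h (x := n) (pow_pos hρ n).ne'
    rw [norm_norm, norm_pow, Real.norm_of_nonneg hρ.le] at h1
    exact (T ^ n - φ.smulRight (BV.one V)).le_of_opNorm_le h1 f
  · rintro ⟨C, hC, h⟩
    refine Asymptotics.IsBigO.of_bound C (Eventually.of_forall fun n => ?_)
    rw [norm_norm, norm_pow, Real.norm_of_nonneg hρ.le]
    exact ContinuousLinearMap.opNorm_le_bound _ (mul_nonneg hC.le (pow_pos hρ n).le) (h n)

theorem convergenceRate_eq (hP : ActsOnBV P V) (hV : Integrable V π) :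
    convergenceRate P V hP π = sInf {ρ : ℝ | ρ ∈ Ioo (0 : ℝ) 1 ∧
      ConvergesAtRate (kernelOp P V hP) (BV.one V) (BV.integralCLM V π hV) ρ} := by
  rw [convergenceRate]
  congr 1
  ext ρ
  exact and_congr_right fun hρ => isBigO_iff_convergesAtRate hP hV hρ.1

theorem convergenceRate_le (hP : ActsOnBV P V) (hV : Integrable V π) {ρ : ℝ}
    (hρ : ρ ∈ Ioo (0 : ℝ) 1)
    (h : ConvergesAtRate (kernelOp P V hP) (BV.one V) (BV.integralCLM V π hV) ρ) :
    convergenceRate P V hP π ≤ ρ := by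
  rw [convergenceRate_eq hP hV]
  exact csInf_le ⟨0, fun r hr => hr.1.1.le⟩ ⟨hρ, h⟩

/-- Some rate must be exhibited, since `sInf ∅ = 0` in `ℝ`. -/
theorem le_convergenceRate (hP : ActsOnBV P V) (hV : Integrable V π) {a : ℝ}
    (hne : ∃ ρ ∈ Ioo (0 : ℝ) 1,
      ConvergesAtRate (kernelOp P V hP) (BV.one V) (BV.integralCLM V π hV) ρ)
    (h : ∀ ρ ∈ Ioo (0 : ℝ) 1,
      ConvergesAtRate (kernelOp P V hP) (BV.one V) (BV.integralCLM V π hV) ρ → a ≤ ρ) :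
    a ≤ convergenceRate P V hP π := by
  rw [convergenceRate_eq hP hV]
  exact le_csInf hne fun ρ hρ => h ρ hρ.1 hρ.2

end KernelOperator

/-! ### Essential spectral radius and rate of convergence -/

section SpectralRate

variable {E : Type*} [NormedAddCommGroup E] [NormedSpace ℂ E]

/-- A power-bounded quasi-compact operator with `1` as simple eigenvalue and only eigenvalue of
modulus one has powers converging exponentially fast. -/
theorem exists_convergesAtRate_of_isQuasiCompact [CompleteSpace E] {T : E →L[ℂ] E} {e : E}
    {φ : E →L[ℂ] ℂ} (hT : IsPowerBounded T) (hqc : IsQuasiCompact T)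
    (he : powKer T 1 1 = Submodule.span ℂ {e}) (h1 : ∀ μ : ℂ, IsEigenvalue T μ → ‖μ‖ = 1 → μ = 1)
    (hTe : T e = e) (hφe : φ e = 1) (hφT : ∀ f, φ (T f) = φ f) :
    ∃ ρ ∈ Ioo (0 : ℝ) 1, ConvergesAtRate T e φ ρ := by
  obtain ⟨r, hr, hsplit⟩ := hqc
  -- Only finitely many eigenvalues have modulus above `r`, so some `ρ < 1` exceeds all those moduli
  -- that are below `1`.
  have hρ : ∀ᶠ ρ in nhdsWithin (1 : ℝ) (Iio 1), (r < ρ ∧ ρ < 1) ∧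
      ∀ μ ∈ {μ : ℂ | IsEigenvalue T μ ∧ r < ‖μ‖}, ‖μ‖ < 1 → ‖μ‖ < ρ := by
    refine Filter.Eventually.and (Ioo_mem_nhdsLT hr.2)
      ((eventually_all_finite (hsplit.finite_eigenvalues hr.1)).2 fun μ _ => ?_)
    by_cases hμ : ‖μ‖ < 1
    · exact (show ∀ᶠ ρ in nhdsWithin (1 : ℝ) (Iio 1), ‖μ‖ < ρ ∧ ρ < 1 from
        Ioo_mem_nhdsLT hμ).mono fun ρ h _ => h.1
    · exact Eventually.of_forall fun ρ h => absurd h hμ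
  obtain ⟨ρ, ⟨hrρ, hρ1⟩, hρ⟩ := hρ.exists
  refine ⟨ρ, ⟨hr.1.trans hrρ, hρ1⟩, convergesAtRate_of_span_sup_decaySubmodule
    ⟨hr.1.trans hrρ, hρ1⟩ hTe hφe hφT
    (hsplit.span_sup_decaySubmodule hr.1 hrρ.le hT he fun μ hμ _ hμ1 => ?_)⟩
  rcases le_or_gt ‖μ‖ r with h | h
  · exact h.trans_lt hrρ
  · exact hρ μ ⟨hμ, h⟩
      (lt_of_le_of_ne (hT.norm_eigenvalue_le hμ) fun h' => hμ1 (h1 μ hμ h'))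

theorem exists_hasQuasiCompactSplitting_lt {T : E →L[ℂ] E} (hqc : IsQuasiCompact T) {r₀ : ℝ}
    (h : essSpectralRadius T < r₀) : ∃ r, 0 < r ∧ r < r₀ ∧ HasQuasiCompactSplitting T r := by
  obtain ⟨r, hr, hlt⟩ := exists_lt_of_csInf_lt (s := {r₀ : ℝ | r₀ ∈ Ioo (0 : ℝ) 1 ∧
    HasQuasiCompactSplitting T r₀}) hqc h
  exact ⟨r, hr.1.1, hlt, hr.2⟩

theorem essSpectralRadius_le {T : E →L[ℂ] E} {r : ℝ} (hr : r ∈ Ioo (0 : ℝ) 1)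
    (h : HasQuasiCompactSplitting T r) : essSpectralRadius T ≤ r :=
  csInf_le ⟨0, fun _ hs => hs.1.1.le⟩ ⟨hr, h⟩

theorem finite_eigenvalues_of_essSpectralRadius_lt {T : E →L[ℂ] E} (hqc : IsQuasiCompact T)
    {r₀ : ℝ} (h : essSpectralRadius T < r₀) : {μ : ℂ | IsEigenvalue T μ ∧ r₀ ≤ ‖μ‖}.Finite := by
  obtain ⟨r, hr, hlt, hsplit⟩ := exists_hasQuasiCompactSplitting_lt hqc h
  exact (hsplit.finite_eigenvalues hr).subset fun μ hμ => ⟨hμ.1, hlt.trans_le hμ.2⟩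

namespace ConvergesAtRate

variable {T : E →L[ℂ] E} {e : E} {φ : E →L[ℂ] ℂ} {ρ : ℝ}

theorem isQuasiCompact (h : ConvergesAtRate T e φ ρ) (hρ : ρ ∈ Ioo (0 : ℝ) 1) (hTe : T e = e)
    (hφe : φ e = 1) (hφT : ∀ f, φ (T f) = φ f) : IsQuasiCompact T := by
  obtain ⟨r, hρr, hr⟩ := exists_between hρ.2
  exact ⟨r, ⟨hρ.1.trans hρr, hr⟩, h.hasQuasiCompactSplitting hρ.1 hρr hr.le hTe hφe hφT⟩

theorem essSpectralRadius_le (h : ConvergesAtRate T e φ ρ) (hρ : ρ ∈ Ioo (0 : ℝ) 1)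
    (hTe : T e = e) (hφe : φ e = 1) (hφT : ∀ f, φ (T f) = φ f) : essSpectralRadius T ≤ ρ := by
  -- Admissibility asks for a strict inequality, so it is known only for `r > ρ`; let `r` decrease
  -- to `ρ`.
  refine le_of_forall_gt_imp_ge_of_dense fun a ha => ?_
  obtain ⟨r, hρr, hr⟩ := exists_between (lt_min ha hρ.2)
  have hr1 := hr.trans_le (min_le_right _ _)
  exact (_root_.essSpectralRadius_le ⟨hρ.1.trans hρr, hr1⟩
    (h.hasQuasiCompactSplitting hρ.1 hρr hr1.le hTe hφe hφT)).trans (hr.trans_le (min_le_left _ _)).le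

/-- The rate of convergence can be improved to any `ρ' ≥ r₀ > r_ess(T)` exceeding the moduli of the
eigenvalues in the annulus `r₀ ≤ |μ| < 1`. -/
theorem improve [CompleteSpace E] (h : ConvergesAtRate T e φ ρ) (hρ : ρ ∈ Ioo (0 : ℝ) 1)
    (hTe : T e = e) (hφe : φ e = 1) (hφT : ∀ f, φ (T f) = φ f) {r₀ ρ' : ℝ}
    (hr₀ : essSpectralRadius T < r₀) (hr₀ρ' : r₀ ≤ ρ') (hρ' : ρ' < 1)
    (hμ : ∀ μ, IsEigenvalue T μ → r₀ ≤ ‖μ‖ → ‖μ‖ < 1 → ‖μ‖ < ρ') : ConvergesAtRate T e φ ρ' := by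
  obtain ⟨r, hr, hlt, hsplit⟩ :=
    exists_hasQuasiCompactSplitting_lt (h.isQuasiCompact hρ hTe hφe hφT) hr₀
  have hr' := hlt.trans_le hr₀ρ'
  refine convergesAtRate_of_span_sup_decaySubmodule ⟨hr.trans hr', hρ'⟩ hTe hφe hφT
    (hsplit.span_sup_decaySubmodule hr hr'.le (h.isPowerBounded hρ) (h.powKer_one_eq hρ hTe hφe)
      fun μ hev _ hμ1 => ?_)
  rcases lt_or_ge ‖μ‖ r₀ with h0 | h0
  · exact h0.trans_le hr₀ρ'
  · exact hμ μ hev h0 ((h.norm_eigenvalue_le hρ.1 hφT hev hμ1).trans_lt hρ.2)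

end ConvergesAtRate

end SpectralRate

end

/-! ### The equivalence and the formulas for the rate -/

theorem proposition1 {X : Type*} [MeasurableSpace X] (P : Kernel X X) [IsMarkovKernel P]
    (V : WeightFn X) (π : Measure X) [IsProbabilityMeasure π]
    (hπ : Kernel.Invariant P π) (hπV : Integrable V π) :
    (IsVGeometricallyErgodic P V π ↔
      ∃ hP : ActsOnBV P V,
        IsPowerBounded (kernelOp P V hP) ∧ IsQuasiCompact (kernelOp P V hP) ∧
        powKer (kernelOp P V hP) 1 1 = Submodule.span ℂ {BV.one V} ∧
        ∀ μ : ℂ, IsEigenvalue (kernelOp P V hP) μ ∧ ‖μ‖ = 1 ↔ μ = 1) ∧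
    (IsVGeometricallyErgodic P V π →
      ∃ hP : ActsOnBV P V,
        essSpectralRadius (kernelOp P V hP) ≤ convergenceRate P V hP π ∧
        (∀ r₀ ∈ Ioo (essSpectralRadius (kernelOp P V hP)) 1,
          (annulusEigenvalues P V hP r₀ = ∅ → convergenceRate P V hP π ≤ r₀) ∧
          ((annulusEigenvalues P V hP r₀).Nonempty →
            IsGreatest ((fun μ : ℂ => ‖μ‖) '' annulusEigenvalues P V hP r₀)
              (convergenceRate P V hP π))) ∧
        ((∀ r₀ ∈ Ioo (essSpectralRadius (kernelOp P V hP)) 1,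
            annulusEigenvalues P V hP r₀ = ∅) →
          convergenceRate P V hP π = essSpectralRadius (kernelOp P V hP))) := by
  have key := fun hP : ActsOnBV P V => integralCLM_kernelOp hP hπ hπV
  have hφe := BV.integralCLM_one (V := V) hπV
  rw [isVGeometricallyErgodic_iff hπV]
  refine ⟨⟨?_, ?_⟩, ?_⟩
  · rintro ⟨hP, ρ, hρ, h⟩
    have hTe := kernelOp_one hP
    exact ⟨hP, h.isPowerBounded hρ, h.isQuasiCompact hρ hTe hφe (key hP),
      h.powKer_one_eq hρ hTe hφe,
      h.isEigenvalue_and_norm_eq_one_iff hρ hTe hφe (key hP)⟩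
  · rintro ⟨hP, hpb, hqc, he, h1⟩
    exact ⟨hP, exists_convergesAtRate_of_isQuasiCompact hpb hqc he
      (fun μ hμ hμ1 => (h1 μ).1 ⟨hμ, hμ1⟩) (kernelOp_one hP) hφe (key hP)⟩
  · rintro ⟨hP, ρ, hρ, h⟩
    have hTe := kernelOp_one hP
    have hφT := key hP
    have hqc := h.isQuasiCompact hρ hTe hφe hφT
    have hess : essSpectralRadius (kernelOp P V hP) ≤ convergenceRate P V hP π :=
      le_convergenceRate hP hπV ⟨ρ, hρ, h⟩ fun ρ' hρ' h' =>
        h'.essSpectralRadius_le hρ' hTe hφe hφT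
    have hess0 : 0 ≤ essSpectralRadius (kernelOp P V hP) := Real.sInf_nonneg fun r hr => hr.1.1.le
    -- With no eigenvalue in the annulus, `r₀` itself is a rate.
    have hempty : ∀ r₀ ∈ Ioo (essSpectralRadius (kernelOp P V hP)) 1,
        annulusEigenvalues P V hP r₀ = ∅ → convergenceRate P V hP π ≤ r₀ := fun r₀ hr₀ hV =>
      convergenceRate_le hP hπV ⟨hess0.trans_lt hr₀.1, hr₀.2⟩
        (h.improve hρ hTe hφe hφT hr₀.1 le_rfl hr₀.2 fun μ h1 h2 h3 =>
          absurd (show μ ∈ annulusEigenvalues P V hP r₀ from ⟨h1, h2, h3⟩) (hV ▸ notMem_empty μ))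
    refine ⟨hP, hess, fun r₀ hr₀ => ⟨hempty r₀ hr₀, fun hne => ?_⟩, fun hall => ?_⟩
    · have hfin : (annulusEigenvalues P V hP r₀).Finite :=
        (finite_eigenvalues_of_essSpectralRadius_lt hqc hr₀.1).subset fun μ hμ => ⟨hμ.1, hμ.2.1⟩
      -- The annulus lies outside the essential radius, so it holds finitely many eigenvalues and
      -- the maximal modulus is attained. Every `ρ'` in `(‖ν‖, 1)` is then a rate, and no rate is
      -- below `‖ν‖`.
      obtain ⟨ν, hν, hmax⟩ := hfin.exists_maximalFor (fun μ : ℂ => ‖μ‖) _ hne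
      have hle : ∀ μ ∈ annulusEigenvalues P V hP r₀, ‖μ‖ ≤ ‖ν‖ := fun μ hμ =>
        (le_total ‖μ‖ ‖ν‖).elim id fun h' => hmax hμ h'
      have hrate : convergenceRate P V hP π = ‖ν‖ := by
        apply le_antisymm
        · refine le_of_forall_gt_imp_ge_of_dense fun a ha => ?_
          obtain ⟨ρ', hνρ', hρ'⟩ := exists_between (lt_min ha hν.2.2)
          have hρ'1 := hρ'.trans_le (min_le_right _ _)
          exact (convergenceRate_le hP hπV ⟨(norm_nonneg ν).trans_lt hνρ', hρ'1⟩
            (h.improve hρ hTe hφe hφT hr₀.1 (hν.2.1.trans hνρ'.le) hρ'1 fun μ h1 h2 h3 =>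
              (hle μ ⟨h1, h2, h3⟩).trans_lt hνρ')).trans (hρ'.trans_le (min_le_left _ _)).le
        · refine le_convergenceRate hP hπV ⟨ρ, hρ, h⟩ fun ρ' hρ' h' =>
            h'.norm_eigenvalue_le hρ'.1 hφT hν.1 ?_
          rintro rfl
          exact absurd hν.2.2 (by simp)
      rw [hrate]
      exact ⟨⟨ν, hν, rfl⟩, by rintro _ ⟨μ, hμ, rfl⟩; exact hle μ hμ⟩
    · refine le_antisymm (le_of_forall_gt_imp_ge_of_dense fun a ha => ?_) hess
      -- Since `r_ess < 1`, some `r₀` fits between `r_ess` and `min a 1`.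
      have hess1 := (h.essSpectralRadius_le hρ hTe hφe hφT).trans_lt hρ.2
      obtain ⟨r₀, h1, h2⟩ := exists_between (lt_min ha hess1)
      have hr₀ := And.intro h1 (h2.trans_le (min_le_right _ _))
      exact (hempty r₀ hr₀ (hall r₀ hr₀)).trans (h2.trans_le (min_le_left _ _)).le
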